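/- Let $P_0$ be a probability measure on $\mathbb{R}^m$ and $T>0$. Let $\varphi_t:\mathbb{R}^m\to\mathbb{R}^m$, $0\le t<T$, be a continuous denoising autoencoder trained for $P_0$. That is: each $\varphi_t$ is measurable, the pushforward measure $\varphi_{t\sharp}P_0$ has a positive differentiable density $p_t$ with respect to Lebesgue measure, the score field $(t,x)\mapsto\nabla\log p_t(x)$ is continuous on $[0,T)\times\mathbb{R}^m$, and $\varphi$ is the flow of this field: $$\varphi_0(x)=x,\qquad \partial_t\varphi_t(x)=\nabla\log p_t(\varphi_t(x))\qquad (0\le t<T,\ x\in\mathbb{R}^m).$$ By a classical solution of an equation $\partial_t u_t=\pm\triangle u_t$ on $I\times\mathbb{R}^m$, where $I$ is an interval, we mean a function $u$ such that $u_t$ is $C^2$ for each $t\in I$, both $u$ and $\triangle u$ are continuous on $I\times\mathbb{R}^m$, and the equation holds at every point (with one-sided time derivatives at end points belonging to $I$). Then $p_t$ is a classical solution on $[0,T)\times\mathbb{R}^m$ of the backward heat equation $$\partial_t p_t=-\triangle p_t,$$ and its initial value is the data distribution: $p_{t=0}$ is a density of $P_0$. Moreover, for every $\tau\in(0,T)$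 this is equivalent to a final value problem for the ordinary heat equation, in the following sense. (a) A function $q$ is a classical solution of $\partial_t q_t=-\triangle q_t$ on $[0,\tau]\times\mathbb{R}^m$ such that $q_0$ is a density of $P_0$ if and only if $u_t:=q_{\tau-t}$ is a classical solution of $\partial_t u_t=\triangle u_t$ on $[0,\tau]\times\mathbb{R}^m$ such that $u_{\tau}$ is a density of $P_0$. (b) If $u_t$, $0\le t\le\tau$, are probability densities, then $u$ is a classical solution of the final value problem $\partial_t u_t=\triangle u_t$ on $[0,\tau]\times\mathbb{R}^m$ with $u_\tau$ a density of $P_0$ if and only if $p_t=u_{\tau-t}$ for all $0\le t\le\tau$. -/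

import Mathlib

open MeasureTheory Set

noncomputable section

/-- `f` is a probability density on `ℝᵐ`. -/
def IsProbabilityDensity {m : ℕ} (f : EuclideanSpace ℝ (Fin m) → ℝ) : Prop :=
  (∀ x, 0 ≤ f x) ∧ Integrable f volume ∧ ∫ x, f x = 1

/-- `f` is a density of the measure `P` on `ℝᵐ`. -/
def IsDensityOf {m : ℕ} (f : EuclideanSpace ℝ (Fin m) → ℝ)
    (P : Measure (EuclideanSpace ℝ (Fin m))) : Prop :=
  (∀ x, 0 ≤ f x) ∧ P = volume.withDensity (fun x => ENNReal.ofReal (f x))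

/-- The score `∇ log f` of a density `f`. -/
def score {m : ℕ} (f : EuclideanSpace ℝ (Fin m) → ℝ) (x : EuclideanSpace ℝ (Fin m)) :
    EuclideanSpace ℝ (Fin m) :=
  gradient (fun y => Real.log (f y)) x

/-- `φ` is a continuous denoising autoencoder trained for the data distribution `P₀`, on the
time interval `[0, T)`, and `p t` is the density of the pushforward of `P₀` under `φ t`.
The pushforwards have positive densities whose scores exist and form a continuous
time-dependent velocity field, and `φ` is the flow (solution operator) of this field. -/
structure IsContinuousDAE {m : ℕ} (T : ℝ) (P₀ : Measure (EuclideanSpace ℝ (Fin m)))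
    (φ : ℝ → EuclideanSpace ℝ (Fin m) → EuclideanSpace ℝ (Fin m))
    (p : ℝ → EuclideanSpace ℝ (Fin m) → ℝ) : Prop where
  measurable : ∀ t ∈ Ico 0 T, Measurable (φ t)
  pushforward : ∀ t ∈ Ico 0 T, IsDensityOf (p t) (P₀.map (φ t))
  pos : ∀ t ∈ Ico 0 T, ∀ x, 0 < p t x
  differentiable : ∀ t ∈ Ico 0 T, Differentiable ℝ (p t)
  continuousOn_score : ContinuousOn
    (fun z : ℝ × EuclideanSpace ℝ (Fin m) => score (p z.1) z.2) (Ico 0 T ×ˢ univ)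
  initial : ∀ x, φ 0 x = x
  flow : ∀ x, ∀ t ∈ Ico 0 T,
    HasDerivWithinAt (fun s => φ s x) (score (p t) (φ t x)) (Ico 0 T) t

/-- `u` is a classical solution on `I × ℝᵐ` of `∂ₜ u = c Δ u`: twice continuously differentiable in
space, with `u` and `Δ u` jointly continuous (one-sided time derivatives at end points of `I`). -/
structure SolvesDiffusion {m : ℕ} (c : ℝ) (I : Set ℝ)
    (u : ℝ → EuclideanSpace ℝ (Fin m) → ℝ) : Prop where
  contDiff : ∀ t ∈ I, ContDiff ℝ 2 (u t)
  continuousOn : ContinuousOn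
    (fun z : ℝ × EuclideanSpace ℝ (Fin m) => u z.1 z.2) (I ×ˢ univ)
  continuousOn_laplacian : ContinuousOn
    (fun z : ℝ × EuclideanSpace ℝ (Fin m) => Laplacian.laplacian (u z.1) z.2)
    (I ×ˢ univ)
  equation : ∀ t ∈ I, ∀ x,
    HasDerivWithinAt (fun s => u s x) (c * Laplacian.laplacian (u t) x) I t

/-- The heat equation `∂ₜ u = Δ u` on `I × ℝᵐ`. -/
def SolvesHeat {m : ℕ} (I : Set ℝ) (u : ℝ → EuclideanSpace ℝ (Fin m) → ℝ) : Prop :=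
  SolvesDiffusion 1 I u

/-- The backward heat equation `∂ₜ u = - Δ u` on `I × ℝᵐ`. -/
def SolvesBackwardHeat {m : ℕ} (I : Set ℝ) (u : ℝ → EuclideanSpace ℝ (Fin m) → ℝ) : Prop :=
  SolvesDiffusion (-1) I u

end

/-! Formally, the continuity equation gives `∂ₜ p = -div (p ∇ log p)`, and `p ∇ log p = ∇p`, so `∂ₜ
p = -Δp`. The difficulty is regularity: `p t` is only differentiable in space, and nothing is
assumed about its dependence on time beyond continuity of the score.

So the equation is first proved weakly. Differentiating `∫ f (φ t x) ∂P₀` along the flow and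
integrating by parts once gives `-∫ Δf ∂μ_t`, where `μ_t = P₀.map (φ t)`
(`IsContinuousDAE.solvesWeakDiffusion`). Testing with cut-off plane waves and removing the cut-off,
which finite mass permits, shows that the characteristic function at time `s` is `exp (-(t -
s)‖ξ‖²)` times the one at any later time `t` (`SolvesWeakDiffusion.charFun_eq`). Every time before
`T` has a later time before `T`, so every characteristic function has Gaussian decay. Fourier
inversion then writes `p t` as an integral that can be differentiated under the integral sign, which
makes it a classical solution (`solvesBackwardHeat_re_fourier_heatSymbol`).

Uniqueness uses the same formula. A classical solution made of probability densities is a weak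
solution, so its characteristic functions are determined by that of `P₀`; continuous densities of
the same measure coincide. -/

open scoped Topology FourierTransform

/-! ### Laplacian identities and integration by parts -/

section Calculus

variable {E : Type*} [NormedAddCommGroup E] [InnerProductSpace ℝ E] [FiniteDimensional ℝ E]

/-- The Laplacian as a sum of iterated directional derivatives. -/
theorem laplacian_eq_sum_fderiv_fderiv {F : Type*} [NormedAddCommGroup F] [NormedSpace ℝ F]
    {ι : Type*} [Fintype ι] (b : OrthonormalBasis ι ℝ E) {f : E → F} (hf : ContDiff ℝ 2 f) (x : E) :
    Laplacian.laplacian f x = ∑ i, fderiv ℝ (fun y => fderiv ℝ f y (b i)) x (b i) := by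
  rw [InnerProductSpace.laplacian_eq_iteratedFDeriv_orthonormalBasis f b]
  refine Finset.sum_congr rfl fun i _ => ?_
  have h1 : DifferentiableAt ℝ (fderiv ℝ f) x :=
    ((hf.fderiv_right (m := 1) (by norm_num)).differentiable (by norm_num)) x
  rw [iteratedFDeriv_two_apply, fderiv_clm_apply h1 (by fun_prop)]
  simp

omit [FiniteDimensional ℝ E] in
theorem ContDiff.contDiff_fderiv_apply_const {F : Type*} [NormedAddCommGroup F] [NormedSpace ℝ F]
    {f : E → F} (hf : ContDiff ℝ 2 f) (v : E) : ContDiff ℝ 1 (fun y => fderiv ℝ f y v) :=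
  (hf.fderiv_right (m := 1) (by norm_num)).clm_apply contDiff_const

theorem ContDiff.continuous_laplacian {F : Type*} [NormedAddCommGroup F] [NormedSpace ℝ F]
    {f : E → F} (hf : ContDiff ℝ 2 f) : Continuous (Laplacian.laplacian f) := by
  have : Laplacian.laplacian f = fun x =>
      ∑ i, fderiv ℝ (fun y => fderiv ℝ f y (stdOrthonormalBasis ℝ E i)) x
        (stdOrthonormalBasis ℝ E i) :=
    funext fun x => laplacian_eq_sum_fderiv_fderiv _ hf x
  rw [this]
  exact continuous_finsetSum _ fun i _ =>
    ((hf.contDiff_fderiv_apply_const _).continuous_fderiv (by norm_num)).clm_apply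
      continuous_const

theorem tsupport_laplacian_subset {F : Type*} [NormedAddCommGroup F] [NormedSpace ℝ F]
    (f : E → F) : tsupport (Laplacian.laplacian f) ⊆ tsupport f := by
  refine closure_minimal (fun x hx => ?_) (isClosed_tsupport f)
  by_contra h
  have h0 : f =ᶠ[𝓝 x] fun _ => 0 := notMem_tsupport_iff_eventuallyEq.mp h
  apply hx
  simpa using (InnerProductSpace.laplacian_congr_nhds h0).eq_of_nhds

theorem HasCompactSupport.laplacian {F : Type*} [NormedAddCommGroup F] [NormedSpace ℝ F]
    {f : E → F} (hf : HasCompactSupport f) : HasCompactSupport (Laplacian.laplacian f) :=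
  hf.mono' ((subset_tsupport _).trans (tsupport_laplacian_subset f))

/-- The product rule for the Laplacian. -/
theorem laplacian_mul {ι : Type*} [Fintype ι] (b : OrthonormalBasis ι ℝ E) {f g : E → ℝ}
    (hf : ContDiff ℝ 2 f) (hg : ContDiff ℝ 2 g) (x : E) :
    Laplacian.laplacian (fun y => f y * g y) x = f x * Laplacian.laplacian g x +
      2 * (∑ i, fderiv ℝ f x (b i) * fderiv ℝ g x (b i)) + g x * Laplacian.laplacian f x := by
  have hfd := hf.differentiable (by norm_num)
  have hgd := hg.differentiable (by norm_num)
  rw [laplacian_eq_sum_fderiv_fderiv b (hf.mul hg), laplacian_eq_sum_fderiv_fderiv b hf,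
    laplacian_eq_sum_fderiv_fderiv b hg, Finset.mul_sum, Finset.mul_sum, Finset.mul_sum,
    ← Finset.sum_add_distrib, ← Finset.sum_add_distrib]
  refine Finset.sum_congr rfl fun i _ => ?_
  have h1 : (fun y => fderiv ℝ (fun y => f y * g y) y (b i)) =
      fun y => f y * fderiv ℝ g y (b i) + g y * fderiv ℝ f y (b i) := by
    funext y
    rw [fderiv_fun_mul (hfd y) (hgd y)]
    simp
  have hf2 := (hf.contDiff_fderiv_apply_const (b i)).differentiable (by norm_num)
  have hg2 := (hg.contDiff_fderiv_apply_const (b i)).differentiable (by norm_num)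
  rw [h1, fderiv_fun_add ((hfd x).fun_mul (hg2 x)) ((hgd x).fun_mul (hf2 x)),
    fderiv_fun_mul (hfd x) (hg2 x), fderiv_fun_mul (hgd x) (hf2 x)]
  simp
  ring

omit [FiniteDimensional ℝ E] in
theorem fderiv_comp_const_smul_apply {f : E → ℝ} (hf : Differentiable ℝ f) (c : ℝ) (x v : E) :
    fderiv ℝ (fun y => f (c • y)) x v = c * fderiv ℝ f (c • x) v := by
  have h1 : HasFDerivAt (fun y : E => c • y) (c • ContinuousLinearMap.id ℝ E) x :=
    (hasFDerivAt_id x).const_smul c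
  have h2 : fderiv ℝ (fun y => f (c • y)) x = _ := ((hf (c • x)).hasFDerivAt.comp x h1).fderiv
  rw [h2]
  simp

theorem laplacian_comp_const_smul {f : E → ℝ} (hf : ContDiff ℝ 2 f) (c : ℝ) (x : E) :
    Laplacian.laplacian (fun y => f (c • y)) x = c ^ 2 * Laplacian.laplacian f (c • x) := by
  have hfc : ContDiff ℝ 2 fun y => f (c • y) := hf.comp (contDiff_id.const_smul c)
  rw [laplacian_eq_sum_fderiv_fderiv (stdOrthonormalBasis ℝ E) hfc,
    laplacian_eq_sum_fderiv_fderiv (stdOrthonormalBasis ℝ E) hf, Finset.mul_sum]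
  refine Finset.sum_congr rfl fun i _ => ?_
  have hf2 := (hf.contDiff_fderiv_apply_const (stdOrthonormalBasis ℝ E i)).differentiable
    (by norm_num)
  simp_rw [fderiv_comp_const_smul_apply (hf.differentiable (by norm_num))]
  have hd : DifferentiableAt ℝ
      (fun y => fderiv ℝ f (c • y) (stdOrthonormalBasis ℝ E i)) x :=
    (hf2 (c • x)).comp x (differentiableAt_id.const_smul c)
  rw [fderiv_const_mul hd]
  have := fderiv_comp_const_smul_apply hf2 c x (stdOrthonormalBasis ℝ E i)
  simp only [smul_apply, smul_eq_mul, this]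
  ring

-- The phase `θ` keeps test functions real: `θ = 0` and `θ = -π/2` give the real and imaginary parts
-- of a plane wave.
omit [FiniteDimensional ℝ E] in
theorem contDiff_cos_inner_add (ξ : E) (θ : ℝ) {n : WithTop ℕ∞} :
    ContDiff ℝ n fun x : E => Real.cos (inner ℝ ξ x + θ) :=
  Real.contDiff_cos.comp ((contDiff_const.inner ℝ contDiff_id).add contDiff_const)

omit [FiniteDimensional ℝ E] in
theorem fderiv_cos_inner_add_apply (ξ : E) (θ : ℝ) (x v : E) :
    fderiv ℝ (fun x : E => Real.cos (inner ℝ ξ x + θ)) x v =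
      -Real.sin (inner ℝ ξ x + θ) * inner ℝ ξ v := by
  have h : HasFDerivAt (fun x : E => inner ℝ ξ x + θ) (innerSL ℝ ξ) x :=
    (innerSL ℝ ξ).hasFDerivAt.add_const θ
  rw [h.cos.fderiv]
  simp

theorem laplacian_cos_inner_add (ξ : E) (θ : ℝ) (x : E) :
    Laplacian.laplacian (fun x : E => Real.cos (inner ℝ ξ x + θ)) x =
      -‖ξ‖ ^ 2 * Real.cos (inner ℝ ξ x + θ) := by
  rw [laplacian_eq_sum_fderiv_fderiv (stdOrthonormalBasis ℝ E) (contDiff_cos_inner_add ξ θ),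
    ← (stdOrthonormalBasis ℝ E).sum_sq_norm_inner_left ξ, neg_mul, Finset.sum_mul,
    ← Finset.sum_neg_distrib]
  refine Finset.sum_congr rfl fun i _ => ?_
  simp_rw [fderiv_cos_inner_add_apply]
  have h : HasFDerivAt (fun x : E => inner ℝ ξ x + θ) (innerSL ℝ ξ) x :=
    (innerSL ℝ ξ).hasFDerivAt.add_const θ
  rw [(h.sin.fun_neg.mul_const _).fderiv]
  simp
  ring

theorem sum_fderiv_mul_fderiv_eq_fderiv_gradient {ι : Type*} [Fintype ι]
    (b : OrthonormalBasis ι ℝ E) (f g : E → ℝ) (x : E) :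
    ∑ i, fderiv ℝ f x (b i) * fderiv ℝ g x (b i) = fderiv ℝ f x (gradient g x) := by
  conv_rhs => rw [← b.sum_repr (gradient g x)]
  simp only [map_sum, map_smul, smul_eq_mul, b.repr_apply_apply]
  refine Finset.sum_congr rfl fun i _ => ?_
  rw [real_inner_comm, gradient, InnerProductSpace.toDual_symm_apply, mul_comm]

variable [MeasurableSpace E] [BorelSpace E]

/-- Integration by parts against a compactly supported function. -/
theorem integral_mul_fderiv_eq_neg_of_hasCompactSupport {f g : E → ℝ} (hf : ContDiff ℝ 1 f)
    (hfc : HasCompactSupport f) (hg : ContDiff ℝ 1 g) (v : E) :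
    ∫ x, f x * fderiv ℝ g x v = -∫ x, fderiv ℝ f x v * g x := by
  have hf' : Continuous fun x => fderiv ℝ f x v :=
    (hf.continuous_fderiv (by norm_num)).clm_apply continuous_const
  have hg' : Continuous fun x => fderiv ℝ g x v :=
    (hg.continuous_fderiv (by norm_num)).clm_apply continuous_const
  apply integral_mul_fderiv_eq_neg_fderiv_mul_of_integrable
  · exact (hf'.mul hg.continuous).integrable_of_hasCompactSupport
      (hfc.fderiv_apply (𝕜 := ℝ) v).mul_right
  · exact (hf.continuous.mul hg').integrable_of_hasCompactSupport hfc.mul_right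
  · exact (hf.continuous.mul hg.continuous).integrable_of_hasCompactSupport hfc.mul_right
  · exact fun x _ => hf.differentiable (by norm_num) x
  · exact fun x _ => hg.differentiable (by norm_num) x

/-- Green's first identity, for a compactly supported test function. -/
theorem integral_fderiv_gradient_eq_neg_integral_laplacian_mul {f g : E → ℝ}
    (hf : ContDiff ℝ 2 f) (hfc : HasCompactSupport f) (hg : ContDiff ℝ 1 g) :
    ∫ x, fderiv ℝ f x (gradient g x) = -∫ x, Laplacian.laplacian f x * g x := by
  let b := stdOrthonormalBasis ℝ E
  simp_rw [← sum_fderiv_mul_fderiv_eq_fderiv_gradient b, laplacian_eq_sum_fderiv_fderiv b hf,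
    Finset.sum_mul]
  have hg' : ∀ v, Continuous fun x => fderiv ℝ g x v := fun v =>
    (hg.continuous_fderiv (by norm_num)).clm_apply continuous_const
  rw [integral_finsetSum, integral_finsetSum, ← Finset.sum_neg_distrib]
  · exact Finset.sum_congr rfl fun i _ => integral_mul_fderiv_eq_neg_of_hasCompactSupport
      (hf.contDiff_fderiv_apply_const _) (hfc.fderiv_apply (𝕜 := ℝ) _) hg _
  · intro i _
    exact (((hf.contDiff_fderiv_apply_const _).continuous_fderiv (by norm_num)).clm_apply
      continuous_const |>.mul hg.continuous).integrable_of_hasCompactSupport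
      ((hfc.fderiv_apply (𝕜 := ℝ) _).fderiv_apply (𝕜 := ℝ) _).mul_right
  · intro i _
    exact ((hf.contDiff_fderiv_apply_const _).continuous.mul
      (hg' _)).integrable_of_hasCompactSupport (hfc.fderiv_apply (𝕜 := ℝ) _).mul_right

/-- Green's second identity, for a compactly supported test function. -/
theorem integral_mul_laplacian_eq_integral_laplacian_mul {f g : E → ℝ}
    (hf : ContDiff ℝ 2 f) (hfc : HasCompactSupport f) (hg : ContDiff ℝ 2 g) :
    ∫ x, f x * Laplacian.laplacian g x = ∫ x, Laplacian.laplacian f x * g x := by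
  let b := stdOrthonormalBasis ℝ E
  have h := integral_fderiv_gradient_eq_neg_integral_laplacian_mul hf hfc (hg.of_le (by norm_num))
  rw [← neg_eq_iff_eq_neg.mpr h]
  simp_rw [← sum_fderiv_mul_fderiv_eq_fderiv_gradient b, laplacian_eq_sum_fderiv_fderiv b hg,
    Finset.mul_sum]
  have hg' : ∀ v, Continuous fun x => fderiv ℝ g x v := fun v =>
    (hg.contDiff_fderiv_apply_const v).continuous
  rw [integral_finsetSum, integral_finsetSum, ← Finset.sum_neg_distrib]
  · exact Finset.sum_congr rfl fun i _ => integral_mul_fderiv_eq_neg_of_hasCompactSupport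
      (hf.of_le (by norm_num)) hfc (hg.contDiff_fderiv_apply_const _) _
  · intro i _
    exact ((hf.contDiff_fderiv_apply_const _).continuous.mul
      (hg' _)).integrable_of_hasCompactSupport (hfc.fderiv_apply (𝕜 := ℝ) _).mul_right
  · intro i _
    exact (hf.continuous.mul (((hg.contDiff_fderiv_apply_const _).continuous_fderiv
      (by norm_num)).clm_apply continuous_const)).integrable_of_hasCompactSupport hfc.mul_right

end Calculus

/-! ### Weak solutions and their characteristic functions -/

section WeakSolutions

variable {E : Type*} [NormedAddCommGroup E] [InnerProductSpace ℝ E] [FiniteDimensional ℝ E]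

/-- Cut-off plane waves are approximate eigenfunctions of the Laplacian. -/
theorem exists_abs_laplacian_cutoff_mul_cos_le {χ : E → ℝ} (hχ : ContDiff ℝ 2 χ)
    (hχc : HasCompactSupport χ) (ξ : E) (θ : ℝ) :
    ∃ C : ℝ, 0 ≤ C ∧ ∀ ε ∈ Ioc (0 : ℝ) 1, ∀ x : E,
      |Laplacian.laplacian (fun y => χ (ε • y) * Real.cos (inner ℝ ξ y + θ)) x +
        ‖ξ‖ ^ 2 * (χ (ε • x) * Real.cos (inner ℝ ξ x + θ))| ≤ C * ε := by
  let b := stdOrthonormalBasis ℝ E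
  obtain ⟨K, hK⟩ := (hχ.continuous_fderiv (by norm_num)).bounded_above_of_compact_support
    (hχc.fderiv (𝕜 := ℝ))
  obtain ⟨M, hM⟩ := hχ.continuous_laplacian.bounded_above_of_compact_support hχc.laplacian
  have hK0 : 0 ≤ K := (norm_nonneg _).trans (hK 0)
  have hM0 : 0 ≤ M := (norm_nonneg _).trans (hM 0)
  -- In the product rule the term `χ Δcos` cancels against `‖ξ‖² χ cos`. Each coordinate of the
  -- cross term is at most `ε K ‖ξ‖`, and the term with `Δχ` is at most `ε² M ≤ ε M`.
  refine ⟨2 * (∑ _i : Fin (Module.finrank ℝ E), K * ‖ξ‖) + M, by positivity, ?_⟩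
  rintro ε ⟨hε0, hε1⟩ x
  rw [laplacian_mul b (f := fun y => χ (ε • y)) (hχ.comp (contDiff_id.const_smul ε)) (contDiff_cos_inner_add ξ θ),
    laplacian_cos_inner_add, laplacian_comp_const_smul hχ]
  simp_rw [fderiv_comp_const_smul_apply (hχ.differentiable (by norm_num)),
    fderiv_cos_inner_add_apply]
  have h1 : |∑ i, ε * fderiv ℝ χ (ε • x) (b i) *
      (-Real.sin (inner ℝ ξ x + θ) * inner ℝ ξ (b i))| ≤ ε * ∑ _i : Fin (Module.finrank ℝ E),
        K * ‖ξ‖ := by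
    refine (Finset.abs_sum_le_sum_abs _ _).trans ?_
    rw [Finset.mul_sum]
    refine Finset.sum_le_sum fun i _ => ?_
    have hb : ‖b i‖ = 1 := b.orthonormal.1 i
    have e1 : |fderiv ℝ χ (ε • x) (b i)| ≤ K := by
      have := (fderiv ℝ χ (ε • x)).le_opNorm (b i)
      rw [hb, mul_one] at this
      exact this.trans (hK _)
    have e2 : |inner ℝ ξ (b i)| ≤ ‖ξ‖ := by
      have := abs_real_inner_le_norm ξ (b i)
      rwa [hb, mul_one] at this
    have e3 : |Real.sin (inner ℝ ξ x + θ)| ≤ 1 := Real.abs_sin_le_one _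
    rw [abs_mul, abs_mul, abs_mul, abs_neg, abs_of_pos hε0, mul_assoc]
    gcongr
    calc |Real.sin (inner ℝ ξ x + θ)| * |inner ℝ ξ (b i)| ≤ 1 * ‖ξ‖ := by gcongr
      _ = ‖ξ‖ := one_mul _
  have h2 : |Real.cos (inner ℝ ξ x + θ) * (ε ^ 2 * Laplacian.laplacian χ (ε • x))| ≤ M * ε := by
    have e1 : |Laplacian.laplacian χ (ε • x)| ≤ M := hM _
    have e3 : |Real.cos (inner ℝ ξ x + θ)| ≤ 1 := Real.abs_cos_le_one _
    rw [abs_mul, abs_mul, abs_of_pos (pow_pos hε0 2)]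
    calc |Real.cos (inner ℝ ξ x + θ)| * (ε ^ 2 * |Laplacian.laplacian χ (ε • x)|)
        ≤ 1 * (ε * M) := by
          gcongr
          nlinarith
      _ = M * ε := by ring
  rw [show ∀ p q r s : ℝ, p * (-‖ξ‖ ^ 2 * q) + 2 * r + s + ‖ξ‖ ^ 2 * (p * q) = 2 * r + s by
    intros; ring]
  refine (abs_add_le _ _).trans ?_
  rw [abs_mul, abs_of_pos (zero_lt_two' ℝ)]
  linarith

variable [MeasurableSpace E] [BorelSpace E]

/-- `μ` is a weak (measure-valued) solution of `∂ₜ μ = c Δ μ` on `[a, b]`. -/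
structure SolvesWeakDiffusion (c a b : ℝ) (μ : ℝ → Measure E) : Prop where
  continuousOn : ∀ f : E → ℝ, ContDiff ℝ 2 f → HasCompactSupport f →
    ContinuousOn (fun t => ∫ x, f x ∂μ t) (Icc a b)
  hasDerivAt : ∀ f : E → ℝ, ContDiff ℝ 2 f → HasCompactSupport f → ∀ t ∈ Ioo a b,
    HasDerivAt (fun s => ∫ x, f x ∂μ s) (c * ∫ x, Laplacian.laplacian f x ∂μ t) t

omit [BorelSpace E] in
theorem SolvesWeakDiffusion.mono {c a b a' b' : ℝ} {μ : ℝ → Measure E}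
    (h : SolvesWeakDiffusion c a b μ) (ha : a ≤ a') (hb : b' ≤ b) :
    SolvesWeakDiffusion c a' b' μ where
  continuousOn f hf hfc := (h.continuousOn f hf hfc).mono (Icc_subset_Icc ha hb)
  hasDerivAt f hf hfc t ht := h.hasDerivAt f hf hfc t (Ioo_subset_Ioo ha hb ht)

omit [FiniteDimensional ℝ E] in
theorem tendsto_integral_cutoff_mul_cos (μ : Measure E) [IsFiniteMeasure μ] {χ : E → ℝ}
    (hχ : Continuous χ) (hχ0 : χ 0 = 1) (hχ1 : ∀ x, |χ x| ≤ 1) (ξ : E) (θ : ℝ) :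
    Filter.Tendsto (fun ε : ℝ => ∫ x, χ (ε • x) * Real.cos (inner ℝ ξ x + θ) ∂μ) (𝓝[>] 0)
      (𝓝 (∫ x, Real.cos (inner ℝ ξ x + θ) ∂μ)) := by
  refine tendsto_integral_filter_of_dominated_convergence (fun _ => 1) ?_ ?_
    (integrable_const 1) ?_
  · refine Filter.Eventually.of_forall fun ε => Continuous.aestronglyMeasurable ?_
    fun_prop
  · refine Filter.Eventually.of_forall fun ε => Filter.Eventually.of_forall fun x => ?_
    rw [norm_mul]
    exact mul_le_one₀ (hχ1 _) (norm_nonneg _) (Real.abs_cos_le_one _)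
  · refine Filter.Eventually.of_forall fun x => ?_
    have h : Continuous fun ε : ℝ => χ (ε • x) * Real.cos (inner ℝ ξ x + θ) := by fun_prop
    have := (h.tendsto 0).mono_left (nhdsWithin_le_nhds (s := Ioi 0))
    simpa [hχ0] using this

/-- Plane waves evolve exponentially under a weak solution of the diffusion equation. -/
theorem SolvesWeakDiffusion.exp_mul_integral_cos_eq {c a b : ℝ} {μ : ℝ → Measure E}
    (h : SolvesWeakDiffusion c a b μ) (hab : a ≤ b)
    (hμ : ∀ t ∈ Icc a b, IsProbabilityMeasure (μ t)) (ξ : E) (θ : ℝ) :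
    Real.exp (c * b * ‖ξ‖ ^ 2) * ∫ x, Real.cos (inner ℝ ξ x + θ) ∂μ b =
      Real.exp (c * a * ‖ξ‖ ^ 2) * ∫ x, Real.cos (inner ℝ ξ x + θ) ∂μ a := by
  rcases hab.eq_or_lt with rfl | hab
  · rfl
  let χ : ContDiffBump (0 : E) := ⟨1, 2, one_pos, one_lt_two⟩
  have hχ : ContDiff ℝ 2 χ := χ.contDiff
  obtain ⟨C, hC0, hC⟩ := exists_abs_laplacian_cutoff_mul_cos_le hχ χ.hasCompactSupport ξ θ
  have hχ0 : χ 0 = 1 := χ.one_of_mem_closedBall (by simp [χ])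
  have hχ1 : ∀ x, |χ x| ≤ 1 := fun x => by
    rw [abs_of_nonneg χ.nonneg]; exact χ.le_one
  obtain ⟨A, hA⟩ := isCompact_Icc.exists_bound_of_continuousOn
    (f := fun t => Real.exp (c * t * ‖ξ‖ ^ 2)) (s := Icc a b) (by fun_prop)
  have hA0 : 0 ≤ A := (norm_nonneg _).trans (hA a ⟨le_rfl, hab.le⟩)
  let D : ℝ := A * (|c| * C) * (b - a)
  let f : ℝ → E → ℝ := fun ε x => χ (ε • x) * Real.cos (inner ℝ ξ x + θ)
  have key : ∀ ε ∈ Ioc (0 : ℝ) 1, |Real.exp (c * b * ‖ξ‖ ^ 2) * ∫ x, f ε x ∂μ b -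
      Real.exp (c * a * ‖ξ‖ ^ 2) * ∫ x, f ε x ∂μ a| ≤ D * ε := by
    intro ε hε
    have hf : ContDiff ℝ 2 (f ε) :=
      (hχ.comp (contDiff_id.const_smul ε)).mul (contDiff_cos_inner_add ξ θ)
    have hfc : HasCompactSupport (f ε) :=
      (χ.hasCompactSupport.comp_smul hε.1.ne').mul_right
    -- Mean value theorem for the plane wave times its integrating factor: the derivative is the
    -- factor times `c ∫ (Δf + ‖ξ‖² f)`, which is `O(ε)` because `μ t` has mass one.
    obtain ⟨t, ht, heq⟩ := exists_hasDerivAt_eq_slope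
      (fun t => Real.exp (c * t * ‖ξ‖ ^ 2) * ∫ x, f ε x ∂μ t)
      (fun t => Real.exp (c * t * ‖ξ‖ ^ 2) * (c * ‖ξ‖ ^ 2) * (∫ x, f ε x ∂μ t) +
        Real.exp (c * t * ‖ξ‖ ^ 2) * (c * ∫ x, Laplacian.laplacian (f ε) x ∂μ t)) hab
      ((by fun_prop : Continuous fun t => Real.exp (c * t * ‖ξ‖ ^ 2)).continuousOn.mul
        (h.continuousOn _ hf hfc))
      (fun t ht => by
        have h1 : HasDerivAt (fun t => Real.exp (c * t * ‖ξ‖ ^ 2))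
            (Real.exp (c * t * ‖ξ‖ ^ 2) * (c * ‖ξ‖ ^ 2)) t := by
          simpa using (((hasDerivAt_id t).const_mul c).mul_const (‖ξ‖ ^ 2)).exp
        exact h1.mul (h.hasDerivAt _ hf hfc t ht))
    have htI : t ∈ Icc a b := Ioo_subset_Icc_self ht
    have := hμ t htI
    have hba : 0 < b - a := sub_pos.mpr hab
    rw [eq_div_iff hba.ne'] at heq
    rw [← heq]
    have hi1 : Integrable (f ε) (μ t) := hf.continuous.integrable_of_hasCompactSupport hfc
    have hi2 : Integrable (Laplacian.laplacian (f ε)) (μ t) :=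
      hf.continuous_laplacian.integrable_of_hasCompactSupport hfc.laplacian
    have h2 : |∫ x, (Laplacian.laplacian (f ε) x + ‖ξ‖ ^ 2 * f ε x) ∂μ t| ≤ C * ε := by
      have := norm_integral_le_of_norm_le_const (μ := μ t)
        (f := fun x => Laplacian.laplacian (f ε) x + ‖ξ‖ ^ 2 * f ε x) (Filter.Eventually.of_forall (hC ε hε))
      simpa using this
    rw [integral_add hi2 (hi1.const_mul _), integral_const_mul] at h2
    rw [show ∀ e p q : ℝ, e * (c * ‖ξ‖ ^ 2) * p + e * (c * q) = e * (c * (q + ‖ξ‖ ^ 2 * p)) by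
      intros; ring, abs_mul, abs_mul, abs_mul, abs_of_pos hba]
    calc _ ≤ A * (|c| * (C * ε)) * (b - a) := by
          gcongr
          exact hA t htI
      _ = D * ε := by ring
  have := hμ a ⟨le_rfl, hab.le⟩
  have := hμ b ⟨hab.le, le_rfl⟩
  have hlim := (((tendsto_integral_cutoff_mul_cos (μ b) χ.continuous hχ0 hχ1 ξ θ).const_mul
    (Real.exp (c * b * ‖ξ‖ ^ 2))).sub ((tendsto_integral_cutoff_mul_cos (μ a) χ.continuous hχ0 hχ1
    ξ θ).const_mul (Real.exp (c * a * ‖ξ‖ ^ 2)))).abs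
  have hD : Filter.Tendsto (fun ε : ℝ => D * ε) (𝓝[>] 0) (𝓝 0) := by
    have := ((continuous_const_mul D).tendsto 0).mono_left (nhdsWithin_le_nhds (s := Ioi 0))
    simpa using this
  have hle := le_of_tendsto_of_tendsto hlim hD (by
    filter_upwards [Ioc_mem_nhdsGT (zero_lt_one' ℝ)] with ε hε using key ε hε)
  exact sub_eq_zero.mp (abs_nonpos_iff.mp hle)

-- The shift by `-π/2` turns the cosine into the sine.
omit [FiniteDimensional ℝ E] in
theorem charFun_eq_integral_cos_add_sin (μ : Measure E) [IsFiniteMeasure μ] (ξ : E) :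
    charFun μ ξ = ((∫ x, Real.cos (inner ℝ ξ x + 0) ∂μ : ℝ) : ℂ) +
      ((∫ x, Real.cos (inner ℝ ξ x + -(Real.pi / 2)) ∂μ : ℝ) : ℂ) * Complex.I := by
  have hi : ∀ θ : ℝ, Integrable (fun x : E => Real.cos (inner ℝ ξ x + θ)) μ := fun θ =>
    Integrable.of_bound (Continuous.aestronglyMeasurable (by fun_prop)) 1
      (Filter.Eventually.of_forall fun x => Real.abs_cos_le_one _)
  rw [charFun_apply, ← integral_complex_ofReal, ← integral_complex_ofReal,
    ← integral_mul_const, ← integral_add (hi 0).ofReal ((hi _).ofReal.mul_const _)]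
  refine integral_congr_ae (Filter.Eventually.of_forall fun x => ?_)
  simp only
  rw [Complex.exp_mul_I, ← sub_eq_add_neg, Real.cos_sub_pi_div_two, add_zero, real_inner_comm]
  simp

/-- The characteristic function of a weak solution of the diffusion equation. -/
theorem SolvesWeakDiffusion.charFun_eq {c a b : ℝ} {μ : ℝ → Measure E}
    (h : SolvesWeakDiffusion c a b μ) (hab : a ≤ b)
    (hμ : ∀ t ∈ Icc a b, IsProbabilityMeasure (μ t)) (ξ : E) :
    charFun (μ a) ξ = (Real.exp (c * (b - a) * ‖ξ‖ ^ 2) : ℝ) * charFun (μ b) ξ := by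
  have := hμ a ⟨le_rfl, hab⟩
  have := hμ b ⟨hab, le_rfl⟩
  have key : ∀ θ, ∫ x, Real.cos (inner ℝ ξ x + θ) ∂μ a =
      Real.exp (c * (b - a) * ‖ξ‖ ^ 2) * ∫ x, Real.cos (inner ℝ ξ x + θ) ∂μ b := fun θ => by
    have h1 := h.exp_mul_integral_cos_eq hab hμ ξ θ
    rw [show c * (b - a) * ‖ξ‖ ^ 2 = c * b * ‖ξ‖ ^ 2 - c * a * ‖ξ‖ ^ 2 by ring, Real.exp_sub,
      div_mul_eq_mul_div, h1, mul_div_cancel_left₀ _ (Real.exp_pos _).ne']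
  rw [charFun_eq_integral_cos_add_sin, charFun_eq_integral_cos_add_sin (μ b), key, key]
  push_cast
  ring

end WeakSolutions

/-! ### Fourier integrals with Gaussian decay -/

section FourierRegularity

variable {E : Type*} [NormedAddCommGroup E] [InnerProductSpace ℝ E] [FiniteDimensional ℝ E]
  [MeasurableSpace E] [BorelSpace E]

theorem integrable_exp_neg_mul_norm_sq {b : ℝ} (hb : 0 < b) :
    Integrable fun w : E => Real.exp (-b * ‖w‖ ^ 2) := by
  have h := (GaussianFourier.integrable_cexp_neg_mul_sq_norm_add (V := E) (b := (b : ℂ))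
    (by simpa using hb) 0 0).norm
  refine h.congr (Filter.Eventually.of_forall fun w => ?_)
  simp only [zero_mul, add_zero, Complex.norm_exp]
  congr 1
  norm_cast

/-- Half of the Gaussian absorbs the quadratic weight, since `y ≤ exp y` at `y = b‖w‖²/2`; the other
half is integrable. -/
theorem integrable_one_add_norm_sq_mul_exp {b : ℝ} (hb : 0 < b) :
    Integrable fun w : E => (1 + ‖w‖ ^ 2) * Real.exp (-b * ‖w‖ ^ 2) := by
  refine ((integrable_exp_neg_mul_norm_sq (E := E) (half_pos hb)).const_mul (1 + 2 / b)).mono'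
    (Continuous.aestronglyMeasurable (by fun_prop)) (Filter.Eventually.of_forall fun w => ?_)
  rw [Real.norm_of_nonneg (by positivity)]
  have h1 : b / 2 * ‖w‖ ^ 2 ≤ Real.exp (b / 2 * ‖w‖ ^ 2) :=
    (by linarith : b / 2 * ‖w‖ ^ 2 ≤ b / 2 * ‖w‖ ^ 2 + 1).trans (Real.add_one_le_exp _)
  have h2 : 1 ≤ Real.exp (b / 2 * ‖w‖ ^ 2) := Real.one_le_exp (by positivity)
  have h3 : ‖w‖ ^ 2 ≤ 2 / b * Real.exp (b / 2 * ‖w‖ ^ 2) := by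
    calc ‖w‖ ^ 2 = 2 / b * (b / 2 * ‖w‖ ^ 2) := by field_simp
      _ ≤ _ := by gcongr
  rw [show -b * ‖w‖ ^ 2 = -(b / 2) * ‖w‖ ^ 2 + -(b / 2) * ‖w‖ ^ 2 by ring, Real.exp_add,
    ← mul_assoc]
  gcongr
  calc (1 + ‖w‖ ^ 2) * Real.exp (-(b / 2) * ‖w‖ ^ 2)
      ≤ ((1 + 2 / b) * Real.exp (b / 2 * ‖w‖ ^ 2)) * Real.exp (-(b / 2) * ‖w‖ ^ 2) := by
        gcongr
        linarith
    _ = 1 + 2 / b := by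
        rw [mul_assoc, ← Real.exp_add]
        simp

theorem pow_norm_le_one_add_sq {E : Type*} [NormedAddCommGroup E] (w : E) {n : ℕ} (hn : n ≤ 2) : ‖w‖ ^ n ≤ 1 + ‖w‖ ^ 2 := by
  have := norm_nonneg w
  interval_cases n
  · simp only [pow_zero]; nlinarith
  · nlinarith [sq_nonneg (‖w‖ - 1)]
  · linarith

/-- The Laplacian of a Fourier transform. -/
theorem laplacian_fourier {f : E → ℂ}
    (hf : ∀ n : ℕ, n ≤ 2 → Integrable fun w => ‖w‖ ^ n * ‖f w‖)
    (hfm : AEStronglyMeasurable f) (x : E) :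
    (Laplacian.laplacian (𝓕 f : E → ℂ) : E → ℂ) x = 𝓕 (fun w => -(4 * Real.pi ^ 2 * ‖w‖ ^ 2 : ℝ) * f w) x := by
  have hf' : ∀ n : ℕ, (n : ℕ∞) ≤ (2 : ℕ∞) → Integrable fun w => ‖w‖ ^ n * ‖f w‖ :=
    fun n hn => hf n (by exact_mod_cast hn)
  have hint : Integrable
      (fun v => VectorFourier.fourierPowSMulRight (innerSL ℝ) f v 2) (volume : Measure E) :=
    VectorFourier.integrable_fourierPowSMulRight _ (hf 2 le_rfl) hfm
  rw [InnerProductSpace.laplacian_eq_iteratedFDeriv_orthonormalBasis _ (stdOrthonormalBasis ℝ E),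
    Real.iteratedFDeriv_fourier (N := 2) hf' hfm (le_refl _)]
  simp only [Real.fourier_continuousMultilinearMap_apply hint]
  simp only [Real.fourier_eq]
  rw [← integral_finsetSum]
  · congr 1
    funext w
    rw [← Finset.smul_sum, ← (stdOrthonormalBasis ℝ E).sum_sq_norm_inner_left w]
    congr 1
    simp only [VectorFourier.fourierPowSMulRight_apply, Fin.prod_univ_two, Finset.mul_sum,
      Matrix.cons_val_zero, Matrix.cons_val_one, Complex.real_smul,
      smul_eq_mul, Real.norm_eq_abs, sq_abs]
    push_cast
    rw [← Finset.sum_neg_distrib, Finset.sum_mul]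
    refine Finset.sum_congr rfl fun i _ => ?_
    have hi : innerSL ℝ w (stdOrthonormalBasis ℝ E i) = inner ℝ w (stdOrthonormalBasis ℝ E i) := rfl
    rw [hi]
    linear_combination (4 * (Real.pi : ℂ) ^ 2 * (inner ℝ w (stdOrthonormalBasis ℝ E i) : ℝ) ^ 2 *
      f w) * Complex.I_sq
  · intro i _
    have := (ContinuousMultilinearMap.apply ℝ (fun _ : Fin 2 => E) ℂ
      ![stdOrthonormalBasis ℝ E i, stdOrthonormalBasis ℝ E i]).integrable_comp hint
    exact (Real.fourierIntegral_convergent_iff x).2 this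

/-- The Fourier side of the backward heat flow. -/
noncomputable def heatSymbol (σ : ℝ) (g : E → ℂ) (t : ℝ) (w : E) : ℂ :=
  (Real.exp (-(4 * Real.pi ^ 2 * (σ - t)) * ‖w‖ ^ 2) : ℝ) * g w

variable {σ : ℝ} {g : E → ℂ}

-- The Gaussian factor increases with `t`, so its value at a later time `s` dominates all earlier
-- times at once. This supplies the majorants for the dominated convergence arguments that follow.
omit [InnerProductSpace ℝ E] [FiniteDimensional ℝ E] [MeasurableSpace E] [BorelSpace E] in
theorem norm_heatSymbol_le {B s t : ℝ} (hgB : ∀ w, ‖g w‖ ≤ B) (hts : t ≤ s) (w : E) :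
    ‖heatSymbol σ g t w‖ ≤ B * Real.exp (-(4 * Real.pi ^ 2 * (σ - s)) * ‖w‖ ^ 2) := by
  have hB : 0 ≤ B := (norm_nonneg _).trans (hgB 0)
  rw [heatSymbol, norm_mul, Complex.norm_real, Real.norm_of_nonneg (Real.exp_pos _).le, mul_comm]
  gcongr
  exact hgB w

theorem aestronglyMeasurable_heatSymbol (hg : AEStronglyMeasurable g) (t : ℝ) :
    AEStronglyMeasurable (heatSymbol σ g t) :=
  (Continuous.aestronglyMeasurable (by fun_prop)).mul hg

/-- The integrand of the Fourier representation, with a weight `v` of at most quadratic growth. -/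
noncomputable def heatKernelIntegrand (σ : ℝ) (g : E → ℂ) (v : E → ℝ) (z : ℝ × E) (w : E) : ℂ :=
  Real.fourierChar (-inner ℝ w z.2) • (v w * heatSymbol σ g z.1 w)

theorem fourier_heatSymbol_eq (v : E → ℝ) (t : ℝ) (x : E) :
    𝓕 (fun w => (v w : ℂ) * heatSymbol σ g t w) x =
      ∫ w, heatKernelIntegrand σ g v (t, x) w := by
  rw [Real.fourier_eq]; rfl

theorem aestronglyMeasurable_heatKernelIntegrand (hg : AEStronglyMeasurable g) {v : E → ℝ}
    (hv : Continuous v) (z : ℝ × E) :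
    AEStronglyMeasurable (heatKernelIntegrand σ g v z) := by
  refine AEStronglyMeasurable.smul (𝕜 := Circle) ?_ ?_
  · exact Continuous.aestronglyMeasurable (by fun_prop)
  · exact (Continuous.aestronglyMeasurable (by fun_prop)).mul
      (aestronglyMeasurable_heatSymbol hg _)

omit [FiniteDimensional ℝ E] [MeasurableSpace E] [BorelSpace E] in
theorem norm_heatKernelIntegrand_le {B K s : ℝ} (hgB : ∀ w, ‖g w‖ ≤ B) {v : E → ℝ}
    (hvK : ∀ w, |v w| ≤ K * (1 + ‖w‖ ^ 2)) {z : ℝ × E} (hts : z.1 ≤ s) (w : E) :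
    ‖heatKernelIntegrand σ g v z w‖ ≤
      K * B * ((1 + ‖w‖ ^ 2) * Real.exp (-(4 * Real.pi ^ 2 * (σ - s)) * ‖w‖ ^ 2)) := by
  have h1 := norm_heatSymbol_le (σ := σ) hgB hts w
  have h2 := hvK w
  rw [heatKernelIntegrand, Circle.norm_smul, norm_mul, Complex.norm_real]
  calc |v w| * ‖heatSymbol σ g z.1 w‖ ≤ (K * (1 + ‖w‖ ^ 2)) *
        (B * Real.exp (-(4 * Real.pi ^ 2 * (σ - s)) * ‖w‖ ^ 2)) := by
        gcongr
        exact (abs_nonneg _).trans h2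
    _ = _ := by ring

theorem integrable_heat_bound {s : ℝ} (hs : s < σ) (A : ℝ) :
    Integrable fun w : E => A * ((1 + ‖w‖ ^ 2) *
      Real.exp (-(4 * Real.pi ^ 2 * (σ - s)) * ‖w‖ ^ 2)) :=
  (integrable_one_add_norm_sq_mul_exp
    (mul_pos (by positivity) (sub_pos.mpr hs))).const_mul A

/-- Used with `v = 1` for the solution itself and with `v = 4π²‖w‖²` for its Laplacian, up to sign.
-/
theorem continuousOn_fourier_heatSymbol {B K : ℝ} (hg : AEStronglyMeasurable g)
    (hgB : ∀ w, ‖g w‖ ≤ B) {v : E → ℝ} (hv : Continuous v)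
    (hvK : ∀ w, |v w| ≤ K * (1 + ‖w‖ ^ 2)) :
    ContinuousOn (fun z : ℝ × E => 𝓕 (fun w => (v w : ℂ) * heatSymbol σ g z.1 w) z.2)
      (Iio σ ×ˢ univ) := by
  rintro ⟨t, x⟩ ⟨ht, -⟩
  simp_rw [fourier_heatSymbol_eq]
  -- The gap between `t` and `σ` leaves room for an `s` whose majorant is integrable and valid near
  -- `t`.
  obtain ⟨s, hts, hs⟩ := exists_between (show t < σ from ht)
  have hnhds : ∀ᶠ z : ℝ × E in 𝓝 (t, x), z.1 < s :=
    continuous_fst.continuousAt.eventually (Iio_mem_nhds hts)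
  refine (continuousAt_of_dominated (Filter.Eventually.of_forall fun z =>
    aestronglyMeasurable_heatKernelIntegrand hg hv z) (hnhds.mono fun z hz =>
      Filter.Eventually.of_forall fun w => norm_heatKernelIntegrand_le hgB hvK hz.le w)
    (integrable_heat_bound hs _)
    (Filter.Eventually.of_forall fun w => ?_)).continuousWithinAt
  unfold heatKernelIntegrand heatSymbol
  fun_prop

theorem hasDerivAt_fourier_heatSymbol {B : ℝ} (hg : AEStronglyMeasurable g)
    (hgB : ∀ w, ‖g w‖ ≤ B) {t : ℝ} (ht : t < σ) (x : E) :
    HasDerivAt (fun t => 𝓕 (heatSymbol σ g t) x)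
      (𝓕 (fun w => ((4 * Real.pi ^ 2 * ‖w‖ ^ 2 : ℝ) : ℂ) * heatSymbol σ g t w) x) t := by
  obtain ⟨s, hts, hs⟩ := exists_between ht
  have hone : ∀ t, 𝓕 (heatSymbol σ g t) x =
      ∫ w, heatKernelIntegrand σ g (fun _ => 1) (t, x) w := fun t => by
    rw [← fourier_heatSymbol_eq]; simp
  simp_rw [hone]
  rw [fourier_heatSymbol_eq (fun w => 4 * Real.pi ^ 2 * ‖w‖ ^ 2)]
  have hvK : ∀ w : E, |(fun w : E => 4 * Real.pi ^ 2 * ‖w‖ ^ 2) w| ≤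
      4 * Real.pi ^ 2 * (1 + ‖w‖ ^ 2) := fun w => by
    simp only
    rw [abs_of_nonneg (by positivity)]
    gcongr
    linarith
  have hv1 : ∀ w : E, |(fun _ : E => (1 : ℝ)) w| ≤ 1 * (1 + ‖w‖ ^ 2) := fun w => by
    simp only [abs_one, one_mul]
    nlinarith [sq_nonneg ‖w‖]
  refine (hasDerivAt_integral_of_dominated_loc_of_deriv_le (s := Iio s) (Iio_mem_nhds hts)
    (F' := fun t w => heatKernelIntegrand σ g (fun w => 4 * Real.pi ^ 2 * ‖w‖ ^ 2) (t, x) w)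
    (Filter.Eventually.of_forall fun t =>
      aestronglyMeasurable_heatKernelIntegrand hg continuous_const _)
    ((integrable_heat_bound hs (1 * B)).mono'
      (aestronglyMeasurable_heatKernelIntegrand hg continuous_const _)
      (Filter.Eventually.of_forall fun w => norm_heatKernelIntegrand_le hgB hv1 hts.le w))
    (aestronglyMeasurable_heatKernelIntegrand hg (by fun_prop) _)
    (Filter.Eventually.of_forall fun w r hr =>
      norm_heatKernelIntegrand_le hgB hvK (z := (r, x)) (le_of_lt hr) w)
    (integrable_heat_bound hs _) (Filter.Eventually.of_forall fun w r _ => ?_)).2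
  have h1 : HasDerivAt (fun r : ℝ => -(4 * Real.pi ^ 2 * (σ - r)) * ‖w‖ ^ 2)
      (4 * Real.pi ^ 2 * ‖w‖ ^ 2) r := by
    have := ((((hasDerivAt_id r).const_sub σ).const_mul (4 * Real.pi ^ 2)).neg.mul_const
      (‖w‖ ^ 2))
    simpa using this
  have h2 := (((h1.exp.ofReal_comp.mul_const (g w)).const_mul ((1 : ℝ) : ℂ))).const_smul
    (Real.fourierChar (-inner ℝ w x))
  refine h2.congr_deriv ?_
  simp only [heatKernelIntegrand, heatSymbol]
  push_cast
  ring_nf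

theorem integrable_pow_mul_norm_heatSymbol {B : ℝ} (hg : AEStronglyMeasurable g)
    (hgB : ∀ w, ‖g w‖ ≤ B) {t : ℝ} (ht : t < σ) {n : ℕ} (hn : n ≤ 2) :
    Integrable fun w : E => ‖w‖ ^ n * ‖heatSymbol σ g t w‖ := by
  refine (integrable_heat_bound ht B).mono' ((Continuous.aestronglyMeasurable (by fun_prop)).mul
    (aestronglyMeasurable_heatSymbol hg t).norm) (Filter.Eventually.of_forall fun w => ?_)
  rw [norm_mul, norm_norm, norm_pow, norm_norm]
  calc ‖w‖ ^ n * ‖heatSymbol σ g t w‖ ≤ (1 + ‖w‖ ^ 2) *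
        (B * Real.exp (-(4 * Real.pi ^ 2 * (σ - t)) * ‖w‖ ^ 2)) := by
        gcongr
        · exact pow_norm_le_one_add_sq w hn
        · exact norm_heatSymbol_le hgB le_rfl w
    _ = _ := by ring

end FourierRegularity

/-- A function whose Fourier transform has Gaussian decay evolves by the backward heat equation. -/
theorem solvesBackwardHeat_re_fourier_heatSymbol {m : ℕ} {σ B : ℝ}
    {g : EuclideanSpace ℝ (Fin m) → ℂ}
    (hg : AEStronglyMeasurable g) (hgB : ∀ w, ‖g w‖ ≤ B) :
    SolvesBackwardHeat (Iio σ) fun t x => (𝓕 (heatSymbol σ g t) x).re := by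
  have hint : ∀ t < σ, ∀ n : ℕ, n ≤ 2 →
      Integrable fun w => ‖w‖ ^ n * ‖heatSymbol σ g t w‖ := fun t ht n hn =>
    integrable_pow_mul_norm_heatSymbol hg hgB ht hn
  have hC : ∀ t < σ, ContDiff ℝ 2 (𝓕 (heatSymbol σ g t)) := fun t ht =>
    Real.contDiff_fourier (N := 2) fun n hn => hint t ht n (by exact_mod_cast hn)
  -- Two space derivatives bring down `-4π²‖w‖²`, while the time derivative brings down `+4π²‖w‖²`:
  -- hence the backward sign.
  have hΔ : ∀ t < σ, ∀ x, Laplacian.laplacian (fun x => (𝓕 (heatSymbol σ g t) x).re) x =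
      -(𝓕 (fun w => ((4 * Real.pi ^ 2 * ‖w‖ ^ 2 : ℝ) : ℂ) * heatSymbol σ g t w) x).re := by
    intro t ht x
    have h1 := (hC t ht).contDiffAt.laplacian_CLM_comp_left (l := Complex.reCLM) (x := x)
    have h2 := laplacian_fourier (hint t ht) (aestronglyMeasurable_heatSymbol hg t) x
    simp only [Function.comp_apply, h2] at h1
    refine h1.trans ?_
    simp only [Real.fourier_eq, neg_mul, smul_neg, integral_neg, Complex.reCLM_apply,
      Complex.neg_re]
  refine ⟨fun t ht => Complex.reCLM.contDiff.comp (hC t ht), ?_, ?_, fun t ht x => ?_⟩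
  · have := continuousOn_fourier_heatSymbol (σ := σ) (K := 1) hg hgB (v := fun _ => 1)
      continuous_const fun w => by simp only [abs_one, one_mul]; nlinarith [sq_nonneg ‖w‖]
    simpa [Function.comp_def] using Complex.continuous_re.comp_continuousOn this
  · have := continuousOn_fourier_heatSymbol (σ := σ) (K := 4 * Real.pi ^ 2) hg hgB
      (v := fun w => 4 * Real.pi ^ 2 * ‖w‖ ^ 2) (by fun_prop) fun w => by
        rw [abs_of_nonneg (by positivity)]; gcongr; linarith
    exact (Complex.continuous_re.comp_continuousOn this).neg.congr fun z hz => hΔ _ hz.1 _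
  · rw [hΔ t ht, neg_mul_neg, one_mul]
    exact (Complex.reCLM.hasFDerivAt.comp_hasDerivAt t
      (hasDerivAt_fourier_heatSymbol hg hgB ht x)).hasDerivWithinAt

/-! ### Densities, characteristic functions and Fourier inversion -/

section Densities

variable {m : ℕ}

theorem IsDensityOf.integral_eq {f : EuclideanSpace ℝ (Fin m) → ℝ}
    {P : Measure (EuclideanSpace ℝ (Fin m))} (h : IsDensityOf f P) (hf : Continuous f)
    {F : Type*} [NormedAddCommGroup F] [NormedSpace ℝ F] (g : EuclideanSpace ℝ (Fin m) → F) :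
    ∫ x, g x ∂P = ∫ x, f x • g x := by
  rw [h.2, integral_withDensity_eq_integral_toReal_smul hf.measurable.ennreal_ofReal
    (Filter.Eventually.of_forall fun _ => ENNReal.ofReal_lt_top)]
  simp_rw [ENNReal.toReal_ofReal (h.1 _)]

theorem IsDensityOf.integrable {f : EuclideanSpace ℝ (Fin m) → ℝ}
    {P : Measure (EuclideanSpace ℝ (Fin m))} [IsFiniteMeasure P] (h : IsDensityOf f P)
    (hf : Continuous f) : Integrable f := by
  refine ⟨hf.aestronglyMeasurable, ?_⟩
  rw [hasFiniteIntegral_iff_ofReal (Filter.Eventually.of_forall h.1), ← setLIntegral_univ,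
    ← withDensity_apply _ MeasurableSet.univ, ← h.2]
  exact measure_lt_top _ _

/-- Densities agree almost everywhere, and Lebesgue measure charges every nonempty open set. -/
theorem IsDensityOf.eq_of_continuous {f g : EuclideanSpace ℝ (Fin m) → ℝ}
    {P : Measure (EuclideanSpace ℝ (Fin m))} [IsFiniteMeasure P] (hf : IsDensityOf f P)
    (hg : IsDensityOf g P) (hfc : Continuous f) (hgc : Continuous g) : f = g := by
  have hfin : ∫⁻ x, ENNReal.ofReal (f x) ≠ ⊤ := by
    rw [← setLIntegral_univ, ← withDensity_apply _ MeasurableSet.univ, ← hf.2]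
    exact measure_ne_top _ _
  have h := (withDensity_eq_iff hfc.measurable.ennreal_ofReal.aemeasurable
    hgc.measurable.ennreal_ofReal.aemeasurable hfin).mp (hf.2.symm.trans hg.2)
  refine (Continuous.ae_eq_iff_eq volume hfc hgc).mp (h.mono fun x hx => ?_)
  exact (ENNReal.ofReal_eq_ofReal_iff (hf.1 x) (hg.1 x)).mp hx

theorem IsProbabilityDensity.isProbabilityMeasure {f : EuclideanSpace ℝ (Fin m) → ℝ}
    (h : IsProbabilityDensity f) :
    IsProbabilityMeasure (volume.withDensity fun x => ENNReal.ofReal (f x)) := by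
  constructor
  rw [withDensity_apply _ MeasurableSet.univ, setLIntegral_univ,
    ← ofReal_integral_eq_lintegral_ofReal h.2.1 (Filter.Eventually.of_forall h.1), h.2.2,
    ENNReal.ofReal_one]

theorem IsDensityOf.fourier_eq_charFun {f : EuclideanSpace ℝ (Fin m) → ℝ}
    {P : Measure (EuclideanSpace ℝ (Fin m))} (h : IsDensityOf f P) (hf : Continuous f)
    (w : EuclideanSpace ℝ (Fin m)) :
    𝓕 (fun x => (f x : ℂ)) w = charFun P (-(2 * Real.pi) • w) := by
  rw [Real.fourier_eq', charFun_apply, h.integral_eq hf]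
  refine integral_congr_ae (Filter.Eventually.of_forall fun x => ?_)
  simp only [Complex.real_smul, smul_eq_mul]
  rw [mul_comm, inner_smul_right]
  congr 4
  ring

/-- Fourier inversion for a density whose characteristic function has Gaussian decay. -/
theorem IsDensityOf.eq_re_fourier_heatSymbol {f : EuclideanSpace ℝ (Fin m) → ℝ}
    {P Q : Measure (EuclideanSpace ℝ (Fin m))} [IsProbabilityMeasure P] [IsProbabilityMeasure Q]
    (h : IsDensityOf f P) (hf : Continuous f) {σ t : ℝ} (ht : t < σ)
    (hPQ : ∀ ξ, charFun P ξ = (Real.exp (-1 * (σ - t) * ‖ξ‖ ^ 2) : ℝ) * charFun Q ξ)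
    (x : EuclideanSpace ℝ (Fin m)) :
    f x = (𝓕 (heatSymbol σ (fun w => charFun Q ((2 * Real.pi) • w)) t) x).re := by
  -- The reflection `-w` lets the inverse transform be written as a forward one; `‖2πw‖² = 4π²‖w‖²`
  -- explains the constant in `heatSymbol`.
  have hsym : ∀ w, 𝓕 (fun x => (f x : ℂ)) (-w) =
      heatSymbol σ (fun w => charFun Q ((2 * Real.pi) • w)) t w := fun w => by
    rw [h.fourier_eq_charFun hf, neg_smul_neg, hPQ, heatSymbol, norm_smul, mul_pow]
    congr 3
    rw [Real.norm_eq_abs, sq_abs]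
    ring
  have hg : AEStronglyMeasurable
      (fun w : EuclideanSpace ℝ (Fin m) => charFun Q ((2 * Real.pi) • w)) :=
    (measurable_charFun.comp (measurable_const_smul _)).aestronglyMeasurable
  have hint := integrable_pow_mul_norm_heatSymbol (B := 1) (n := 0) hg
    (fun w => norm_charFun_le_one _) ht (by norm_num)
  simp only [pow_zero, one_mul] at hint
  have hint2 : Integrable (heatSymbol σ (fun w => charFun Q ((2 * Real.pi) • w)) t) :=
    (integrable_norm_iff (aestronglyMeasurable_heatSymbol hg t)).mp hint
  have hF : Integrable (𝓕 fun x => (f x : ℂ)) := by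
    have := hint2.comp_neg
    refine this.congr (Filter.Eventually.of_forall fun w => ?_)
    simp only [← hsym, neg_neg]
  have hinv := congrFun (Continuous.fourierInv_fourier_eq (f := fun x => (f x : ℂ))
    (Complex.continuous_ofReal.comp hf) (h.integrable hf).ofReal hF) x
  rw [Real.fourierInv_eq_fourier_comp_neg] at hinv
  rw [← funext hsym, hinv, Complex.ofReal_re]

end Densities

/-! ### Classical solutions: time reversal, locality, weak form -/

section Diffusions

variable {m : ℕ} {c : ℝ} {I J : Set ℝ} {u v : ℝ → EuclideanSpace ℝ (Fin m) → ℝ}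

theorem SolvesDiffusion.mono (h : SolvesDiffusion c J u) (hIJ : I ⊆ J) :
    SolvesDiffusion c I u where
  contDiff t ht := h.contDiff t (hIJ ht)
  continuousOn := h.continuousOn.mono (prod_mono_left hIJ)
  continuousOn_laplacian := h.continuousOn_laplacian.mono (prod_mono_left hIJ)
  equation t ht x := (h.equation t (hIJ ht) x).mono hIJ

theorem SolvesDiffusion.congr (h : SolvesDiffusion c I u) (huv : ∀ t ∈ I, v t = u t) :
    SolvesDiffusion c I v where
  contDiff t ht := huv t ht ▸ h.contDiff t ht
  continuousOn := h.continuousOn.congr fun z hz => congrFun (huv z.1 hz.1) z.2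
  continuousOn_laplacian := h.continuousOn_laplacian.congr fun z hz => by
    simp only [huv z.1 hz.1]
  equation t ht x := by
    rw [huv t ht]
    exact (h.equation t ht x).congr (fun s hs => congrFun (huv s hs) x) (congrFun (huv t ht) x)

/-- Time reversal. -/
theorem SolvesDiffusion.comp_sub {τ : ℝ} (h : SolvesDiffusion c (Icc 0 τ) u) :
    SolvesDiffusion (-c) (Icc 0 τ) fun t => u (τ - t) := by
  have hmaps : MapsTo (fun t => τ - t) (Icc 0 τ) (Icc 0 τ) := fun t ht =>
    ⟨sub_nonneg.mpr ht.2, sub_le_self _ ht.1⟩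
  have hcomp : ∀ g : ℝ × EuclideanSpace ℝ (Fin m) → ℝ, ContinuousOn g (Icc 0 τ ×ˢ univ) →
      ContinuousOn (fun z => g (τ - z.1, z.2)) (Icc 0 τ ×ˢ univ) := fun g hg =>
    hg.comp (Continuous.continuousOn (by fun_prop)) fun z hz => ⟨hmaps hz.1, trivial⟩
  refine ⟨fun t ht => h.contDiff _ (hmaps ht), hcomp _ h.continuousOn,
    hcomp _ h.continuousOn_laplacian, fun t ht x => ?_⟩
  have h3 : HasDerivWithinAt (fun t => τ - t) (-1) (Icc 0 τ) t :=
    ((hasDerivAt_id t).const_sub τ).hasDerivWithinAt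
  have h4 := HasDerivWithinAt.scomp (g₁ := fun s => u s x) t (h.equation _ (hmaps ht) x) h3 hmaps
  rw [neg_one_smul, ← neg_mul] at h4
  exact h4

/-- The conditions are local in time, and `Ico 0 σ` is a relative neighbourhood of each of its
points. This is needed because the Fourier representation refers to a time `σ < T`. -/
theorem solvesDiffusion_Ico_of_forall_lt {T : ℝ}
    (h : ∀ σ < T, SolvesDiffusion c (Ico 0 σ) u) : SolvesDiffusion c (Ico 0 T) u := by
  have key : ∀ t ∈ Ico 0 T, ∃ σ, t ∈ Ico 0 σ ∧ SolvesDiffusion c (Ico 0 σ) u ∧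
      Ico 0 σ ∈ 𝓝[Ico 0 T] t := by
    intro t ht
    obtain ⟨σ, h1, h2⟩ := exists_between ht.2
    refine ⟨σ, ⟨ht.1, h1⟩, h σ h2, ?_⟩
    filter_upwards [self_mem_nhdsWithin, mem_nhdsWithin_of_mem_nhds (Iio_mem_nhds h1)] with s hs hs'
    exact ⟨hs.1, hs'⟩
  have key2 : ∀ (f : ℝ × EuclideanSpace ℝ (Fin m) → ℝ),
      (∀ σ, SolvesDiffusion c (Ico 0 σ) u → ContinuousOn f (Ico 0 σ ×ˢ univ)) →
      ContinuousOn f (Ico 0 T ×ˢ univ) := by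
    rintro f hf ⟨t, x⟩ ⟨ht, -⟩
    obtain ⟨σ, htσ, hσ, hn⟩ := key t ht
    refine (hf σ hσ (t, x) ⟨htσ, trivial⟩).mono_of_mem_nhdsWithin ?_
    rw [nhdsWithin_prod_eq]
    exact Filter.prod_mem_prod hn Filter.univ_mem
  refine ⟨fun t ht => ?_, key2 _ fun σ hσ => hσ.continuousOn,
    key2 _ fun σ hσ => hσ.continuousOn_laplacian, fun t ht x => ?_⟩
  · obtain ⟨σ, htσ, hσ, -⟩ := key t ht
    exact hσ.contDiff t htσ
  · obtain ⟨σ, htσ, hσ, hn⟩ := key t ht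
    exact (hσ.equation t htσ x).mono_of_mem_nhdsWithin hn

/-- A classical solution of the diffusion equation is a weak solution. -/
theorem SolvesDiffusion.solvesWeakDiffusion {a b : ℝ}
    {μ : ℝ → Measure (EuclideanSpace ℝ (Fin m))} (h : SolvesDiffusion c (Icc a b) u)
    (hμ : ∀ t ∈ Icc a b, IsDensityOf (u t) (μ t)) : SolvesWeakDiffusion c a b μ := by
  have hu : ∀ t ∈ Icc a b, Continuous (u t) := fun t ht => (h.contDiff t ht).continuous
  have hint : ∀ (f : EuclideanSpace ℝ (Fin m) → ℝ), ∀ t ∈ Icc a b,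
      ∫ x, f x ∂μ t = ∫ x, u t x * f x := fun f t ht => (hμ t ht).integral_eq (hu t ht) f
  -- A function continuous on the compact set `Icc a b ×ˢ tsupport f` is bounded there, so a
  -- constant on `tsupport f` is a majorant uniform in time.
  have hbound : ∀ (g : ℝ × EuclideanSpace ℝ (Fin m) → ℝ) (f : EuclideanSpace ℝ (Fin m) → ℝ),
      ContinuousOn g (Icc a b ×ˢ univ) → Continuous f → HasCompactSupport f →
      ∃ K : EuclideanSpace ℝ (Fin m) → ℝ, Integrable K ∧
        ∀ t ∈ Icc a b, ∀ x, ‖g (t, x) * f x‖ ≤ K x := by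
    intro g f hg hf hfc
    obtain ⟨C, hC⟩ := (isCompact_Icc.prod hfc).exists_bound_of_continuousOn
      (f := fun z : ℝ × EuclideanSpace ℝ (Fin m) => g z * f z.2)
      ((hg.mul (Continuous.continuousOn (by fun_prop))).mono (prod_mono_right (subset_univ _)))
    refine ⟨(tsupport f).indicator fun _ => C, (integrable_indicator_iff
      (isClosed_tsupport f).measurableSet).mpr (integrableOn_const hfc.measure_lt_top.ne),
      fun t ht x => ?_⟩
    by_cases hx : x ∈ tsupport f
    · rw [indicator_of_mem hx]
      exact hC (t, x) ⟨ht, hx⟩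
    · rw [indicator_of_notMem hx, image_eq_zero_of_notMem_tsupport hx]
      simp
  refine ⟨fun f hf hfc => ?_, fun f hf hfc t ht => ?_⟩
  · obtain ⟨K, hK, hKb⟩ := hbound _ f h.continuousOn hf.continuous hfc
    refine ContinuousOn.congr ?_ (hint f)
    refine continuousOn_of_dominated (fun t ht =>
      ((hu t ht).mul hf.continuous).aestronglyMeasurable)
      (fun t ht => Filter.Eventually.of_forall (hKb t ht)) hK
      (Filter.Eventually.of_forall fun x => ?_)
    exact ContinuousOn.mul (fun t ht => (h.equation t ht x).continuousWithinAt) continuousOn_const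
  · obtain ⟨K, hK, hKb⟩ := hbound _ f h.continuousOn_laplacian hf.continuous hfc
    have htI := Ioo_subset_Icc_self ht
    have hnhds : Ioo a b ∈ 𝓝 t := Ioo_mem_nhds ht.1 ht.2
    have hD := (hasDerivAt_integral_of_dominated_loc_of_deriv_le
      (F := fun t x => u t x * f x)
      (F' := fun t x => c * Laplacian.laplacian (u t) x * f x) hnhds
      (by
        filter_upwards [hnhds] with r hr
        exact ((hu r (Ioo_subset_Icc_self hr)).mul hf.continuous).aestronglyMeasurable)
      (((hu t htI).mul hf.continuous).integrable_of_hasCompactSupport hfc.mul_left)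
      ((continuous_const.mul (h.contDiff t htI).continuous_laplacian).mul
        hf.continuous).aestronglyMeasurable
      (Filter.Eventually.of_forall fun x r hr => by
        rw [mul_assoc, norm_mul]
        exact mul_le_mul_of_nonneg_left (hKb r (Ioo_subset_Icc_self hr) x) (norm_nonneg c))
      (hK.const_mul ‖c‖)
      (Filter.Eventually.of_forall fun x r hr =>
        ((h.equation r (Ioo_subset_Icc_self hr) x).hasDerivAt
          (Icc_mem_nhds hr.1 hr.2)).mul_const _)).2
    refine (hD.congr_of_eventuallyEq ?_).congr_deriv ?_
    · filter_upwards [hnhds] with r hr using hint f r (Ioo_subset_Icc_self hr)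
    · rw [hint _ t htI]
      simp_rw [mul_assoc]
      rw [integral_const_mul]
      congr 1
      have := integral_mul_laplacian_eq_integral_laplacian_mul hf hfc (h.contDiff t htI)
      simpa only [mul_comm] using this

end Diffusions

/-! ### The flow of the score field -/

section Flow

variable {m : ℕ} {T : ℝ} {P₀ : Measure (EuclideanSpace ℝ (Fin m))}
  {φ : ℝ → EuclideanSpace ℝ (Fin m) → EuclideanSpace ℝ (Fin m)}
  {p : ℝ → EuclideanSpace ℝ (Fin m) → ℝ}

/-- This identity makes the continuity equation linear: the flux of the density along its score is
its gradient. -/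
theorem gradient_eq_smul_score {f : EuclideanSpace ℝ (Fin m) → ℝ} (hf : Differentiable ℝ f)
    (hpos : ∀ x, 0 < f x) (x : EuclideanSpace ℝ (Fin m)) :
    gradient f x = f x • score f x := by
  rw [score, gradient, gradient, fderiv.log (hf x) (hpos x).ne', map_smulₛₗ]
  simp [smul_smul, (hpos x).ne']

theorem IsContinuousDAE.continuous_score (h : IsContinuousDAE T P₀ φ p) {t : ℝ}
    (ht : t ∈ Ico 0 T) : Continuous (score (p t)) :=
  h.continuousOn_score.comp_continuous (f := fun x => (t, x)) (by fun_prop)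
    fun x => ⟨ht, trivial⟩

/-- The gradient is the product of the density and the score, both continuous. Integration by parts
needs this. -/
theorem IsContinuousDAE.contDiff (h : IsContinuousDAE T P₀ φ p) {t : ℝ} (ht : t ∈ Ico 0 T) :
    ContDiff ℝ 1 (p t) := by
  refine contDiff_one_iff_fderiv.mpr ⟨h.differentiable t ht, ?_⟩
  have h1 : fderiv ℝ (p t) =
      fun x => InnerProductSpace.toDual ℝ _ (p t x • score (p t) x) := by
    funext x
    rw [← gradient_eq_smul_score (h.differentiable t ht) (h.pos t ht), gradient,
      LinearIsometryEquiv.apply_symm_apply]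
  rw [h1]
  exact (InnerProductSpace.toDual ℝ _).continuous.comp
    ((h.differentiable t ht).continuous.smul (h.continuous_score ht))

/-- The continuity equation: the distributions transported by a continuous denoising autoencoder
solve the backward heat equation weakly. -/
theorem IsContinuousDAE.solvesWeakDiffusion [IsProbabilityMeasure P₀]
    (h : IsContinuousDAE T P₀ φ p) {τ : ℝ} (hτ : τ < T) :
    SolvesWeakDiffusion (-1) 0 τ fun t => P₀.map (φ t) := by
  have hI : Icc 0 τ ⊆ Ico 0 T := fun t ht => ⟨ht.1, ht.2.trans_lt hτ⟩
  have hI' : Ioo 0 τ ⊆ Ico 0 T := Ioo_subset_Icc_self.trans hI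
  have hint : ∀ (f : EuclideanSpace ℝ (Fin m) → ℝ), Continuous f → ∀ t ∈ Ico 0 T,
      ∫ x, f x ∂(P₀.map (φ t)) = ∫ x, f (φ t x) ∂P₀ := fun f hf t ht =>
    integral_map (h.measurable t ht).aemeasurable hf.aestronglyMeasurable
  refine ⟨fun f hf hfc => ?_, fun f hf hfc t ht => ?_⟩
  · obtain ⟨C, hC⟩ := hf.continuous.bounded_above_of_compact_support hfc
    refine ContinuousOn.congr ?_ fun t ht => hint f hf.continuous t (hI ht)
    refine continuousOn_of_dominated (bound := fun _ => C) (fun t ht =>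
      hf.continuous.aestronglyMeasurable.comp_measurable (h.measurable t (hI ht)))
      (fun t ht => Filter.Eventually.of_forall fun x => hC _) (integrable_const _)
      (Filter.Eventually.of_forall fun x => hf.continuous.comp_continuousOn fun t ht => ?_)
    exact ((h.flow x t (hI ht)).continuousWithinAt).mono hI
  · have hfd : Continuous (fderiv ℝ f) := hf.continuous_fderiv (by norm_num)
    have hdif : Differentiable ℝ f := hf.differentiable (by norm_num)
    obtain ⟨C, hC⟩ := (isCompact_Icc.prod hfc).exists_bound_of_continuousOn
      (f := fun z : ℝ × EuclideanSpace ℝ (Fin m) => fderiv ℝ f z.2 (score (p z.1) z.2))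
      ((hfd.comp continuous_snd).continuousOn.clm_apply
        (h.continuousOn_score.mono (prod_mono hI (subset_univ _))))
    -- The score need not be bounded, but `fderiv ℝ f` vanishes off `tsupport f`. The maximum with
    -- `0` covers those points, as `C` may be negative when the support is empty.
    have hC' : ∀ r ∈ Icc 0 τ, ∀ y, ‖fderiv ℝ f y (score (p r) y)‖ ≤ max C 0 := by
      intro r hr y
      by_cases hy : y ∈ tsupport f
      · exact (hC (r, y) ⟨hr, hy⟩).trans (le_max_left _ _)
      · rw [image_eq_zero_of_notMem_tsupport
          fun hy' => hy (tsupport_fderiv_subset ℝ (f := f) hy')]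
        simp
    have hcont : ∀ r ∈ Ico 0 T, Continuous fun y => fderiv ℝ f y (score (p r) y) := fun r hr =>
      hfd.clm_apply (h.continuous_score hr)
    have hnhds : Ioo 0 τ ∈ 𝓝 t := Ioo_mem_nhds ht.1 ht.2
    obtain ⟨C', hC2⟩ := hf.continuous.bounded_above_of_compact_support hfc
    have hD := (hasDerivAt_integral_of_dominated_loc_of_deriv_le (μ := P₀)
      (F := fun t x => f (φ t x)) (bound := fun _ => max C 0)
      (F' := fun t x => fderiv ℝ f (φ t x) (score (p t) (φ t x))) hnhds
      (by
        filter_upwards [hnhds] with r hr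
        exact hf.continuous.aestronglyMeasurable.comp_measurable (h.measurable r (hI' hr)))
      (Integrable.of_bound (hf.continuous.aestronglyMeasurable.comp_measurable
        (h.measurable t (hI' ht))) C' (Filter.Eventually.of_forall fun x => hC2 _))
      ((hcont t (hI' ht)).aestronglyMeasurable.comp_measurable (h.measurable t (hI' ht)))
      (Filter.Eventually.of_forall fun x r hr => hC' r (Ioo_subset_Icc_self hr) _)
      (integrable_const _)
      (Filter.Eventually.of_forall fun x r hr =>
        (hdif (φ r x)).hasFDerivAt.comp_hasDerivAt r
          ((h.flow x r (hI' hr)).hasDerivAt (Ico_mem_nhds hr.1 (hr.2.trans hτ))))).2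
    refine (hD.congr_of_eventuallyEq ?_).congr_deriv ?_
    · filter_upwards [hnhds] with r hr using hint f hf.continuous r (hI' hr)
    · have hp := h.contDiff (hI' ht)
      have hpush := h.pushforward t (hI' ht)
      -- Against the density of `P₀.map (φ t)` the score becomes the gradient of `p t`, and Green's
      -- first identity yields the Laplacian of `f`.
      rw [← integral_map (h.measurable t (hI' ht)).aemeasurable
        (hcont t (hI' ht)).aestronglyMeasurable, hpush.integral_eq hp.continuous,
        hpush.integral_eq hp.continuous]
      have h1 := integral_fderiv_gradient_eq_neg_integral_laplacian_mul hf hfc hp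
      simp_rw [gradient_eq_smul_score (h.differentiable t (hI' ht)) (h.pos t (hI' ht)),
        map_smul] at h1
      rw [h1]
      simp only [smul_eq_mul, mul_comm, neg_mul, one_mul]

theorem IsContinuousDAE.isProbabilityMeasure_map [IsProbabilityMeasure P₀]
    (h : IsContinuousDAE T P₀ φ p) {t : ℝ} (ht : t ∈ Ico 0 T) :
    IsProbabilityMeasure (P₀.map (φ t)) :=
  Measure.isProbabilityMeasure_map (h.measurable t ht).aemeasurable

/-- Source of the smoothness of `p`: the last factor is bounded by one, so for `s < t` the left side
decays like a Gaussian. -/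
theorem IsContinuousDAE.charFun_map_eq [IsProbabilityMeasure P₀]
    (h : IsContinuousDAE T P₀ φ p) {s t : ℝ} (hs : 0 ≤ s) (hst : s ≤ t) (ht : t < T)
    (ξ : EuclideanSpace ℝ (Fin m)) :
    charFun (P₀.map (φ s)) ξ =
      (Real.exp (-1 * (t - s) * ‖ξ‖ ^ 2) : ℝ) * charFun (P₀.map (φ t)) ξ :=
  ((h.solvesWeakDiffusion ht).mono hs le_rfl).charFun_eq hst
    (fun _ hr => h.isProbabilityMeasure_map ⟨hs.trans hr.1, hr.2.trans_lt ht⟩) ξ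

theorem IsContinuousDAE.solvesBackwardHeat [IsProbabilityMeasure P₀]
    (h : IsContinuousDAE T P₀ φ p) : SolvesBackwardHeat (Ico 0 T) p := by
  refine solvesDiffusion_Ico_of_forall_lt fun σ hσ => ?_
  rcases le_or_gt σ 0 with hσ0 | hσ0
  · rw [Ico_eq_empty hσ0.not_gt]
    exact ⟨by simp, by simp, by simp, by simp⟩
  have := h.isProbabilityMeasure_map ⟨hσ0.le, hσ⟩
  have hmain := solvesBackwardHeat_re_fourier_heatSymbol (σ := σ) (B := 1)
    (g := fun w => charFun (P₀.map (φ σ)) ((2 * Real.pi) • w))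
    (measurable_charFun.comp (measurable_const_smul _)).aestronglyMeasurable
    fun w => norm_charFun_le_one _
  refine (SolvesDiffusion.mono hmain fun t ht => ht.2).congr fun t ht => ?_
  have htT : t ∈ Ico 0 T := ⟨ht.1, ht.2.trans hσ⟩
  have := h.isProbabilityMeasure_map htT
  exact funext fun x => (h.pushforward t htT).eq_re_fourier_heatSymbol
    (h.contDiff htT).continuous ht.2 (h.charFun_map_eq ht.1 ht.2.le hσ) x

theorem IsContinuousDAE.map_zero (h : IsContinuousDAE T P₀ φ p) : P₀.map (φ 0) = P₀ := by
  rw [show φ 0 = id from funext h.initial, Measure.map_id]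

end Flow

/-! ### Uniqueness and the equivalence of the two problems -/

/-- Among families of probability densities, solutions of the final value problem for the heat
equation agree with the time-reversed densities of a continuous denoising autoencoder. -/
theorem IsContinuousDAE.eq_of_solvesHeat {m : ℕ} {T : ℝ}
    {P₀ : Measure (EuclideanSpace ℝ (Fin m))} [IsProbabilityMeasure P₀]
    {φ : ℝ → EuclideanSpace ℝ (Fin m) → EuclideanSpace ℝ (Fin m)}
    {p u : ℝ → EuclideanSpace ℝ (Fin m) → ℝ} (h : IsContinuousDAE T P₀ φ p) {τ : ℝ} (hτ : τ < T)
    (hud : ∀ t ∈ Icc 0 τ, IsProbabilityDensity (u t)) (hu : SolvesHeat (Icc 0 τ) u)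
    (huτ : IsDensityOf (u τ) P₀) {t : ℝ} (ht : t ∈ Icc 0 τ) : p t = u (τ - t) := by
  have htT : t ∈ Ico 0 T := ⟨ht.1, ht.2.trans_lt hτ⟩
  have hτt : τ - t ∈ Icc 0 τ := ⟨sub_nonneg.mpr ht.2, sub_le_self _ ht.1⟩
  let ν : ℝ → Measure (EuclideanSpace ℝ (Fin m)) := fun r =>
    volume.withDensity fun x => ENNReal.ofReal (u r x)
  have hν : ∀ r ∈ Icc 0 τ, IsDensityOf (u r) (ν r) := fun r hr => ⟨(hud r hr).1, rfl⟩
  have hνp : ∀ r ∈ Icc 0 τ, IsProbabilityMeasure (ν r) := fun r hr =>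
    (hud r hr).isProbabilityMeasure
  have hντ : ν τ = P₀ := huτ.2.symm
  have hw := (SolvesDiffusion.solvesWeakDiffusion hu hν).mono hτt.1 le_rfl
  have hP := h.isProbabilityMeasure_map htT
  have := hνp _ hτt
  have heq : ν (τ - t) = P₀.map (φ t) := by
    -- Both characteristic functions equal `exp (t‖ξ‖²)` times that of `P₀`: the forward equation
    -- runs from `τ - t` to `τ`, the backward one from `0` to `t`.
    refine Measure.ext_of_charFun (funext fun ξ => ?_)
    rw [hw.charFun_eq hτt.2 (fun r hr => hνp r ⟨hτt.1.trans hr.1, hr.2⟩) ξ, hντ, ← h.map_zero,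
      h.charFun_map_eq le_rfl ht.1 htT.2 ξ, h.map_zero, ← mul_assoc, ← Complex.ofReal_mul,
      ← Real.exp_add]
    ring_nf
    simp
  exact (h.pushforward t htT).eq_of_continuous (heq ▸ hν _ hτt) (h.contDiff htT).continuous
    (hu.contDiff _ hτt).continuous

theorem theorem2 (m : ℕ) (T : ℝ) (hT : 0 < T)
    (P₀ : Measure (EuclideanSpace ℝ (Fin m))) [IsProbabilityMeasure P₀]
    (φ : ℝ → EuclideanSpace ℝ (Fin m) → EuclideanSpace ℝ (Fin m))
    (p : ℝ → EuclideanSpace ℝ (Fin m) → ℝ)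
    (hφ : IsContinuousDAE T P₀ φ p) :
    -- the backward heat equation, with initial value the data distribution
    (SolvesBackwardHeat (Ico 0 T) p ∧ IsDensityOf (p 0) P₀) ∧
    ∀ τ ∈ Ioo 0 T,
      -- the initial value problem for the backward heat equation is equivalent to the final value
      -- problem for the heat equation by reversing time
      (∀ q : ℝ → EuclideanSpace ℝ (Fin m) → ℝ,
        (SolvesBackwardHeat (Icc 0 τ) q ∧ IsDensityOf (q 0) P₀) ↔
          (SolvesHeat (Icc 0 τ) (fun t => q (τ - t)) ∧
            IsDensityOf (q (τ - τ)) P₀)) ∧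
      -- among families of probability densities, the final value problem characterizes `p`
      (∀ u : ℝ → EuclideanSpace ℝ (Fin m) → ℝ,
        (∀ t ∈ Icc 0 τ, IsProbabilityDensity (u t)) →
          ((SolvesHeat (Icc 0 τ) u ∧ IsDensityOf (u τ) P₀) ↔
            ∀ t ∈ Icc 0 τ, p t = u (τ - t))) := by
  have hmain := hφ.solvesBackwardHeat
  have h0 : IsDensityOf (p 0) P₀ := by
    have := hφ.pushforward 0 ⟨le_rfl, hT⟩
    rwa [hφ.map_zero] at this
  refine ⟨⟨hmain, h0⟩, fun τ hτ => ⟨fun q => ?_, fun u hu => ⟨fun h t ht => ?_, fun h => ?_⟩⟩⟩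
  · rw [sub_self]
    -- Time reversal is an involution, so one lemma serves both directions.
    refine and_congr_left fun _ => ⟨fun h => ?_, fun h => ?_⟩
    · simpa [SolvesHeat] using SolvesDiffusion.comp_sub h
    · simpa [SolvesBackwardHeat] using SolvesDiffusion.comp_sub h
  · exact hφ.eq_of_solvesHeat hτ.2 hu h.1 h.2 ht
  · have hsub : ∀ t ∈ Icc 0 τ, u t = p (τ - t) := fun t ht => by
      rw [h (τ - t) ⟨sub_nonneg.mpr ht.2, sub_le_self _ ht.1⟩, sub_sub_cancel]
    refine ⟨?_, ?_⟩
    · have hp : SolvesDiffusion (-1) (Icc 0 τ) p :=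
        SolvesDiffusion.mono hmain fun t ht => ⟨ht.1, ht.2.trans_lt hτ.2⟩
      have hrev := hp.comp_sub
      rw [neg_neg] at hrev
      exact hrev.congr hsub
    · rw [hsub τ ⟨hτ.1.le, le_rfl⟩, sub_self]
      exact h0
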